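/- Let $d\ge 1$ and let $A\simeq\mathbb C^d$ with a fixed orthonormal basis. Let $C$ be a finite-dimensional complex Hilbert space, and let $\mathcal L(\cdot)$ denote linear operators. For a completely positive (CP) map $\Omega:\mathcal L(\mathbb C^D)\to\mathcal L(K)$ between operators on finite-dimensional spaces, $D\ge 1$, define $$\upsilon_2(\Omega):=\sup_{\Lambda}\bigl\|(\Omega\otimes \mathrm{id}_B)\bigl((\mathrm{id}\otimes\Lambda)(\Phi_D)\bigr)\bigr\|_2 ,$$ where the supremum is over all finite-dimensional spaces $B$ and all completely positive trace-preserving maps $\Lambda:\mathcal L(\mathbb C^D)\to\mathcal L(B)$, $\Phi_D=|\Phi_D\rangle\langle\Phi_D|$ with $|\Phi_D\rangle=D^{-1/2}\sum_{i=1}^D|i\rangle\otimes|i\rangle$ is the normalized maximally entangled state on $\mathbb C^D\otimes\mathbb C^D$, and $\|X\|_2=(\operatorname{Tr}X^\dagger X)^{1/2}$ is the Schatten $2$-norm. For the $n$-fold tensor power $\mathcal N^{\otimes n}$ of a map $\mathcal N:\mathcal L(A)\to\mathcal L(C)$, the space $A^{\otimes n}\simeq\mathbb C^{d^n}$ carries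 the product basis. Let $\mathcal N:\mathcal L(A)\to\mathcal L(C)$ be a CP map with Hilbert–Schmidt adjoint $\mathcal N^\dagger$, and suppose that there are real constants $a,b\ge 0$ such that $$\mathcal N^\dagger\circ\mathcal N=a\,\mathrm{id}_A+b\,\operatorname{Tr}[\cdot]\,I_d .$$ Then $$\upsilon_2(\mathcal N)=\sqrt{\max\Bigl\{a+\frac bd,\ \frac ad+b\Bigr\}},$$ and for every $n\in\mathbb N$, $$\upsilon_2(\mathcal N^{\otimes n})=\bigl(\upsilon_2(\mathcal N)\bigr)^n .$$ -/

import Mathlib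

open scoped ENNReal ComplexOrder Matrix

namespace QMap

noncomputable section

/-- Operators on the Hilbert space `ℂ^ι` with its standard orthonormal basis indexed by `ι`. -/
abbrev Op (ι : Type*) : Type _ := Matrix ι ι ℂ

/-- The map `N ⊗ id_β` on operators on `ℂ^ι ⊗ ℂ^β = ℂ^(ι × β)`: apply `N` to each of the
`β × β` blocks. -/
def tensorId {ι κ : Type*} (N : Op ι →ₗ[ℂ] Op κ) (β : Type*) :
    Op (ι × β) →ₗ[ℂ] Op (κ × β) where
  toFun X := Matrix.of fun r s => N (Matrix.of fun i j => X (i, r.2) (j, s.2)) r.1 s.1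
  map_add' X Y := by
    ext r s
    exact congrFun (congrFun (N.map_add (Matrix.of fun i j => X (i, r.2) (j, s.2))
      (Matrix.of fun i j => Y (i, r.2) (j, s.2))) r.1) s.1
  map_smul' c X := by
    ext r s
    exact congrFun (congrFun (N.map_smul c
      (Matrix.of fun i j => X (i, r.2) (j, s.2))) r.1) s.1

/-- The map `id_α ⊗ L` on operators on `ℂ^α ⊗ ℂ^ι = ℂ^(α × ι)`. -/
def idTensor {ι κ : Type*} (α : Type*) (L : Op ι →ₗ[ℂ] Op κ) :
    Op (α × ι) →ₗ[ℂ] Op (α × κ) where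
  toFun X := Matrix.of fun r s => L (Matrix.of fun i j => X (r.1, i) (s.1, j)) r.2 s.2
  map_add' X Y := by
    ext r s
    exact congrFun (congrFun (L.map_add (Matrix.of fun i j => X (r.1, i) (s.1, j))
      (Matrix.of fun i j => Y (r.1, i) (s.1, j))) r.2) s.2
  map_smul' c X := by
    ext r s
    exact congrFun (congrFun (L.map_smul c
      (Matrix.of fun i j => X (r.1, i) (s.1, j))) r.2) s.2

/-- `N` is completely positive: `N ⊗ id_k` maps positive semidefinite operators to positive
semidefinite operators for every `k`. -/
def IsCP {ι κ : Type*} (N : Op ι →ₗ[ℂ] Op κ) : Prop :=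
  ∀ (k : ℕ) (X : Op (ι × Fin k)), X.PosSemidef → (tensorId N (Fin k) X).PosSemidef

/-- Completely positive and trace preserving maps. -/
def IsCPTP {ι κ : Type*} [Fintype ι] [Fintype κ] (L : Op ι →ₗ[ℂ] Op κ) : Prop :=
  IsCP L ∧ ∀ X : Op ι, (L X).trace = X.trace

/-- The Schatten `p`-norm `(Tr (X† X)^(p/2))^(1/p)`, the trace being evaluated as the sum over
the eigenvalues of `X† X`. -/
def schattenNorm {ι : Type*} [Fintype ι] [DecidableEq ι] (p : ℝ) (X : Op ι) : ℝ :=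
  (∑ i, (Matrix.isHermitian_conjTranspose_mul_self X).eigenvalues i ^ (p / 2)) ^ (1 / p)

/-- The maximally entangled vector `(1/√d) ∑ i, |i⟩ ⊗ |i⟩`, where `d = |ι|`. -/
def maxEntVec (ι : Type*) [Fintype ι] [DecidableEq ι] : ι × ι → ℂ :=
  fun x => if x.1 = x.2 then ((1 / √(Fintype.card ι : ℝ) : ℝ) : ℂ) else 0

/-- The maximally entangled state `|Φ⟩⟨Φ|` on `ℂ^ι ⊗ ℂ^ι`. -/
def maxEntState (ι : Type*) [Fintype ι] [DecidableEq ι] : Op (ι × ι) :=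
  Matrix.vecMulVec (maxEntVec ι) (star (maxEntVec ι))

/-- The constrained maximal output Schatten `p`-norm: the supremum, in `[0, ∞]`, over all finite
output dimensions `m` and all CPTP maps `L : 𝓛(ℂ^ι) → 𝓛(ℂ^m)`, of
`‖(N ⊗ id)((id ⊗ L)(Φ))‖_p`. -/
def upsilon {ι κ : Type*} [Fintype ι] [DecidableEq ι] [Fintype κ] [DecidableEq κ]
    (p : ℝ) (N : Op ι →ₗ[ℂ] Op κ) : ℝ≥0∞ :=
  ⨆ (m : ℕ) (L : Op ι →ₗ[ℂ] Op (Fin m)) (_ : IsCPTP L),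
    ENNReal.ofReal (schattenNorm p (tensorId N (Fin m) (idTensor ι L (maxEntState ι))))

/-- The Hilbert–Schmidt adjoint: the `(i, j)` entry of `N† Y` is `⟨N |i⟩⟨j|, Y⟩`. -/
def hsAdjoint {ι κ : Type*} [DecidableEq ι] [Fintype κ] (N : Op ι →ₗ[ℂ] Op κ) :
    Op κ →ₗ[ℂ] Op ι where
  toFun Y := Matrix.of fun i j => ((N (Matrix.single i j 1))ᴴ * Y).trace
  map_add' X Y := by
    ext i j
    simp [Matrix.mul_add]
  map_smul' c X := by
    ext i j
    simp

/-- `⟨N X, Y⟩ = ⟨X, N† Y⟩` for the Hilbert–Schmidt inner product. -/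
theorem hsAdjoint_spec {ι κ : Type*} [Fintype ι] [DecidableEq ι] [Fintype κ]
    (N : Op ι →ₗ[ℂ] Op κ) (X : Op ι) (Y : Op κ) :
    ((N X)ᴴ * Y).trace = (Xᴴ * hsAdjoint N Y).trace := by
  have hX : N X = ∑ i, ∑ j, X i j • N (Matrix.single i j 1) := by
    conv_lhs => rw [Matrix.matrix_eq_sum_single X]
    simp only [map_sum, ← map_smul, Matrix.smul_single, smul_eq_mul, mul_one]
  rw [hX]
  simp only [Matrix.conjTranspose_sum, Matrix.conjTranspose_smul, Finset.sum_mul,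
    Matrix.trace_sum, Matrix.smul_mul, Matrix.trace_smul]
  rw [Finset.sum_comm]
  simp [Matrix.trace, Matrix.mul_apply, hsAdjoint]

/-- The tensor power `N^{⊗n}`, where `(ℂ^ι)^{⊗n} = ℂ^(Fin n → ι)` with the product basis: the
linear map sending `|i₁⟩⟨j₁| ⊗ ⋯ ⊗ |iₙ⟩⟨jₙ|` to `N(|i₁⟩⟨j₁|) ⊗ ⋯ ⊗ N(|iₙ⟩⟨jₙ|)`. -/
def tensorPow {ι κ : Type*} [Fintype ι] [DecidableEq ι] (N : Op ι →ₗ[ℂ] Op κ) (n : ℕ) :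
    Op (Fin n → ι) →ₗ[ℂ] Op (Fin n → κ) where
  toFun X := Matrix.of fun r s =>
    ∑ i, ∑ j, X i j * ∏ k, N (Matrix.single (i k) (j k) 1) (r k) (s k)
  map_add' X Y := by
    ext r s
    simp [add_mul, Finset.sum_add_distrib]
  map_smul' c X := by
    ext r s
    simp [Finset.mul_sum, mul_assoc]

/-- `N^{⊗n}(X₁ ⊗ ⋯ ⊗ Xₙ) = N(X₁) ⊗ ⋯ ⊗ N(Xₙ)`. -/
theorem tensorPow_prod {ι κ : Type*} [Fintype ι] [DecidableEq ι] (N : Op ι →ₗ[ℂ] Op κ) (n : ℕ)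
    (X : Fin n → Op ι) :
    tensorPow N n (Matrix.of fun i j => ∏ k, X k (i k) (j k)) =
      Matrix.of fun r s => ∏ k, N (X k) (r k) (s k) := by
  have hX : ∀ k, N (X k) = ∑ i, ∑ j, X k i j • N (Matrix.single i j 1) := by
    intro k
    conv_lhs => rw [Matrix.matrix_eq_sum_single (X k)]
    simp only [map_sum, ← map_smul, Matrix.smul_single, smul_eq_mul, mul_one]
  ext r s
  simp only [hX, Matrix.sum_apply, Matrix.smul_apply, smul_eq_mul, Matrix.of_apply, tensorPow,
    LinearMap.coe_mk, AddHom.coe_mk, Finset.prod_univ_sum, Finset.prod_mul_distrib,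
    Fintype.piFinset_univ]

end

end QMap

/-! ### Positivity and permutation symmetry -/

namespace Matrix

variable {α : Type*} [Fintype α]

/-! For `ρ = (id ⊗ Λ)(Φ)`, the squared output norm is quadratic in `ρ` and equals `a Tr ρ² + b Tr
ρ_B²`. On two copies this is `Tr (ρ ⊗ ρ) P S`, where `S = (x + y F) ⊗ 1_BB` with `F` the swap of the
two `A` factors and `x = max a b`, `y = min a b`. The permutation `P` swaps the `B` factors if `a ≤
b`, and swaps both the `A` and the `B` factors if `b ≤ a`. Since `0 ≤ y ≤ x`, `S` is positive; it
commutes with the involution `P`, so `P S ≤ S` (`trace_kronecker_submatrix_le`). Because `ρ_A =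
1/d`, the bound `Tr (ρ ⊗ ρ) S = Tr (x + y F) / d² = x + y / d` does not depend on `Λ`
(`trace_tensorId_le`). It is attained by the trace if `a ≤ b` and by the identity channel if `b ≤
a`. The argument uses only that the kernel `R = x + y F` is positive and swap invariant. Both
properties pass to `R^{⊗n}`, whose trace is `(Tr R)^n`, so `upsilon_two_eq` also gives
multiplicativity. -/

theorem PosSemidef.exists_eq_conjTranspose_mul_self {A : Matrix α α ℂ} (hA : A.PosSemidef) :
    ∃ B : Matrix α α ℂ, A = Bᴴ * B := by
  classical
  open scoped MatrixOrder in
  exact CStarAlgebra.nonneg_iff_eq_star_mul_self.mp hA.nonneg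

theorem PosSemidef.trace_mul_nonneg {A B : Matrix α α ℂ} (hA : A.PosSemidef)
    (hB : B.PosSemidef) : 0 ≤ (A * B).trace := by
  obtain ⟨C, rfl⟩ := hA.exists_eq_conjTranspose_mul_self
  rw [Matrix.mul_assoc, Matrix.trace_mul_comm]
  exact (hB.mul_mul_conjTranspose_same C).trace_nonneg

/-- The tensor power of a positive semidefinite matrix is positive semidefinite. -/
theorem PosSemidef.prod_apply {A : Matrix α α ℂ} (hA : A.PosSemidef) (n : ℕ) :
    (Matrix.of fun f g : Fin n → α => ∏ k, A (f k) (g k)).PosSemidef := by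
  classical
  obtain ⟨B, rfl⟩ := hA.exists_eq_conjTranspose_mul_self
  convert posSemidef_conjTranspose_mul_self
    (Matrix.of fun f g : Fin n → α => ∏ k, B (f k) (g k)) using 1
  ext f g
  simp [Matrix.mul_apply, Finset.prod_univ_sum, Finset.prod_mul_distrib]

/-- If a positive semidefinite `S` commutes with the permutation operator of an involution `σ`,
then `S ± S ∘ σ` is positive semidefinite. -/
theorem PosSemidef.add_smul_submatrix_involutive {S : Matrix α α ℂ} (hS : S.PosSemidef)
    {σ : α → α} (hσ : Function.Involutive σ) (hinv : ∀ p q, S (σ p) (σ q) = S p q)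
    {ε : ℝ} (hε : ε * ε = 1) : (S + (ε : ℂ) • S.submatrix σ id).PosSemidef := by
  classical
  have hinv' : ∀ p q, S p (σ q) = S (σ p) q := fun p q => by rw [← hinv p, hσ q]
  have h := (hS.conjTranspose_mul_mul_same
    ((1 : Matrix α α ℂ) + (ε : ℂ) • (1 : Matrix α α ℂ).submatrix σ id)).smul
      (show (0 : ℝ) ≤ 1 / 2 by norm_num)
  -- With `P` the permutation matrix of `σ`, `S + ε P S = ½ (1 + ε P) S (1 + ε P)`, because `P² =
  -- 1`, `ε² = 1` and `P S = S P`.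
  convert h using 1
  have h1 : ((1 : Matrix α α ℂ).submatrix σ id)ᴴ = (1 : Matrix α α ℂ).submatrix σ id := by
    ext p q
    simp only [conjTranspose_apply, submatrix_apply, one_apply, id]
    have : σ q = p ↔ σ p = q := ⟨fun h => h ▸ hσ q, fun h => h ▸ hσ p⟩
    simp only [this]; split_ifs <;> simp
  have hl : ∀ X : Matrix α α ℂ, (1 : Matrix α α ℂ).submatrix σ id * X = X.submatrix σ id := by
    intro X; ext p q
    simp [mul_apply, one_apply]
  have hr : ∀ X : Matrix α α ℂ, X * (1 : Matrix α α ℂ).submatrix σ id = X.submatrix id σ := by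
    intro X; rw [← h1]; ext p q
    simp [mul_apply, one_apply]
  have hε' : (ε : ℂ) * ε = 1 := by exact_mod_cast hε
  rw [conjTranspose_add, conjTranspose_smul, h1, conjTranspose_one, add_mul, mul_add, one_mul,
    Matrix.smul_mul, hl, mul_one, Matrix.mul_smul, hr]
  ext p q
  simp [hinv, hinv']
  linear_combination -(1 / 2) * S p q * hε'

end Matrix

namespace QMap

/-! ### Output norm through the Gram matrix -/

theorem schattenNorm_two {κ : Type*} [Fintype κ] [DecidableEq κ] (X : Op κ) :
    schattenNorm 2 X = √((Xᴴ * X).trace.re) := by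
  rw [schattenNorm, (Matrix.isHermitian_conjTranspose_mul_self X).trace_eq_sum_eigenvalues,
    Real.sqrt_eq_rpow]
  simp

/-- Exchange the tensor factors and enumerate `α`, since `IsCP` puts the ancilla `Fin k` on the
right. -/
theorem posSemidef_idTensor {ι κ : Type*} {L : Op ι →ₗ[ℂ] Op κ} (hL : IsCP L)
    {α : Type*} [Fintype α] {X : Op (α × ι)} (hX : X.PosSemidef) : (idTensor α L X).PosSemidef := by
  let e := Fintype.equivFin α
  have h := (hL _ (X.submatrix (fun p => (e.symm p.2, p.1)) (fun p => (e.symm p.2, p.1)))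
    (hX.submatrix _)).submatrix (fun p : α × κ => (p.2, e p.1))
  convert h using 1
  ext r s
  simp [idTensor, tensorId]

variable {ι κ : Type*} [Fintype ι] [DecidableEq ι]

theorem apply_eq_sum_single (N : Op ι →ₗ[ℂ] Op κ) (X : Op ι) :
    N X = ∑ i, ∑ j, X i j • N (Matrix.single i j 1) := by
  conv_lhs => rw [Matrix.matrix_eq_sum_single X]
  simp only [map_sum, ← map_smul, Matrix.smul_single, smul_eq_mul, mul_one]

/-- The Gram matrix `⟨N |i'⟩⟨j'|, N |i⟩⟨j|⟩` of the images of the matrix units. -/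
noncomputable def hsGram [Fintype κ] (N : Op ι →ₗ[ℂ] Op κ) (i' j' i j : ι) : ℂ :=
  hsAdjoint N (N (Matrix.single i j 1)) i' j'

theorem trace_conjTranspose_mul_map [Fintype κ] (N : Op ι →ₗ[ℂ] Op κ) (X Y : Op ι) :
    ((N X)ᴴ * N Y).trace =
      ∑ i', ∑ j', ∑ i, ∑ j, star (X i' j') * Y i j * hsGram N i' j' i j := by
  rw [hsAdjoint_spec, apply_eq_sum_single N Y]
  simp only [map_sum, map_smul, Matrix.trace, Matrix.diag, Matrix.mul_apply, hsGram,
    Matrix.conjTranspose_apply, Matrix.sum_apply, Matrix.smul_apply, smul_eq_mul, Finset.mul_sum,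
    mul_assoc]
  rw [Finset.sum_comm]

theorem trace_tensorId {β : Type*} [Fintype κ] [Fintype β] (N : Op ι →ₗ[ℂ] Op κ) (X : Op (ι × β)) :
    ((tensorId N β X)ᴴ * tensorId N β X).trace =
      ∑ u, ∑ v, ∑ i', ∑ j', ∑ i, ∑ j,
        star (X (i', u) (j', v)) * X (i, u) (j, v) * hsGram N i' j' i j := by
  have h := fun u v => trace_conjTranspose_mul_map N (Matrix.of fun i j => X (i, u) (j, v))
    (Matrix.of fun i j => X (i, u) (j, v))
  simp only [Matrix.of_apply] at h
  simp only [← h]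
  simp only [Matrix.trace, Matrix.diag, Matrix.mul_apply, Matrix.conjTranspose_apply,
    Fintype.sum_prod_type, tensorId, LinearMap.coe_mk, AddHom.coe_mk, Matrix.of_apply]
  simp only [← Fintype.sum_prod_type']
  exact Fintype.sum_equiv
    ⟨fun x => (x.2.2.2, x.2.1, x.1, x.2.2.1), fun x => (x.2.2.1, x.2.1, x.2.2.2, x.1),
      fun _ => rfl, fun _ => rfl⟩ _ _ fun _ => rfl

theorem hsGram_tensorPow [Fintype κ] (N : Op ι →ₗ[ℂ] Op κ) (n : ℕ) (i' j' i j : Fin n → ι) :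
    hsGram (tensorPow N n) i' j' i j = ∏ k, hsGram N (i' k) (j' k) (i k) (j k) := by
  have h : ∀ i j : Fin n → ι, tensorPow N n (Matrix.single i j 1) =
      Matrix.of fun r s => ∏ k, N (Matrix.single (i k) (j k) 1) (r k) (s k) := by
    intro i j
    rw [← tensorPow_prod]
    congr 1
    ext r s
    simp [Matrix.single_apply, Finset.prod_ite_zero, funext_iff, forall_and]
  simp only [hsGram, hsAdjoint, LinearMap.coe_mk, AddHom.coe_mk, Matrix.of_apply, h,
    Matrix.trace, Matrix.diag, Matrix.mul_apply, Matrix.conjTranspose_apply, star_prod,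
    ← Finset.prod_mul_distrib, Finset.prod_univ_sum, Fintype.piFinset_univ]

theorem posSemidef_maxEntState : (maxEntState ι).PosSemidef :=
  Matrix.posSemidef_vecMulVec_self_star _

theorem maxEntState_apply (i j k l : ι) : maxEntState ι (i, j) (k, l) =
    if i = j ∧ k = l then ((Fintype.card ι : ℂ))⁻¹ else 0 := by
  have : ((√(Fintype.card ι : ℝ) : ℂ))⁻¹ * ((√(Fintype.card ι : ℝ) : ℂ))⁻¹ =
      (Fintype.card ι : ℂ)⁻¹ := by
    rw [← mul_inv, ← Complex.ofReal_mul, Real.mul_self_sqrt (by positivity)]; simp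
  by_cases h : i = j <;> by_cases h' : k = l <;>
    simp [maxEntState, Matrix.vecMulVec_apply, maxEntVec, h, h', this]

/-- Trace preservation leaves the `A` marginal of `Φ` maximally mixed; this is all the upper bound
needs beyond positivity. -/
theorem sum_idTensor_maxEntState [Fintype κ] {L : Op ι →ₗ[ℂ] Op κ}
    (hL : ∀ X, (L X).trace = X.trace)
    (i j : ι) : ∑ u, idTensor ι L (maxEntState ι) (i, u) (j, u) =
      if i = j then ((Fintype.card ι : ℂ))⁻¹ else 0 := by
  have := hL (Matrix.of fun k l => maxEntState ι (i, k) (j, l))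
  simp only [Matrix.trace, Matrix.diag, Matrix.of_apply, maxEntState_apply] at this
  simp only [idTensor, LinearMap.coe_mk, AddHom.coe_mk, Matrix.of_apply, maxEntState_apply, this]
  by_cases h : i = j
  · simp [h]
  · have : ∀ x, ¬ (i = x ∧ j = x) := fun x hx => h (hx.1.trans hx.2.symm)
    simp [h, this]

/-! ### Upper bound over all channels -/

open scoped Kronecker in
theorem trace_kronecker_submatrix_le {α : Type*} [Fintype α] {ρ : Op α} (hρ : ρ.PosSemidef)
    {S : Op (α × α)} (hS : S.PosSemidef) {σ : α × α → α × α} (hσ : Function.Involutive σ)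
    (hinv : ∀ p q, S (σ p) (σ q) = S p q) :
    ((ρ ⊗ₖ ρ) * S.submatrix σ id).trace ≤ ((ρ ⊗ₖ ρ) * S).trace := by
  have h := (hρ.kronecker hρ).trace_mul_nonneg 
    (hS.add_smul_submatrix_involutive hσ hinv (ε := -1) (by norm_num))
  rw [Complex.ofReal_neg, Complex.ofReal_one, neg_one_smul, ← sub_eq_add_neg, Matrix.mul_sub,
    Matrix.trace_sub] at h
  exact sub_nonneg.mp h

open scoped Kronecker in
theorem trace_tensorId_le [Fintype κ] {β : Type*} [Fintype β] (N : Op ι →ₗ[ℂ] Op κ)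
    {R : Op (ι × ι)} (hR : R.PosSemidef) (hswap : ∀ p q, R (Prod.swap p) (Prod.swap q) = R p q)
    (hN : (∀ i' j' i j, hsGram N i' j' i j = R (i', j) (j', i)) ∨
      ∀ i' j' i j, hsGram N i' j' i j = R (j, i') (j', i))
    {ρ : Op (ι × β)} (hρ : ρ.PosSemidef) {t : ℂ}
    (hA : ∀ i j, ∑ u, ρ (i, u) (j, u) = if i = j then t else 0) :
    ((tensorId N β ρ)ᴴ * tensorId N β ρ).trace ≤ t ^ 2 * R.trace := by
  classical
  let S : Op ((ι × β) × (ι × β)) := (R ⊗ₖ (1 : Op (β × β))).submatrix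
    (fun p => ((p.1.1, p.2.1), (p.1.2, p.2.2))) (fun p => ((p.1.1, p.2.1), (p.1.2, p.2.2)))
  have hS : S.PosSemidef := (hR.kronecker Matrix.PosSemidef.one).submatrix _
  have hSapp : ∀ i i' j j' : ι, ∀ u u' v v' : β, S ((i, u), (j, v)) ((i', u'), (j', v')) =
      if u = u' then if v = v' then R (i, j) (i', j') else 0 else 0 := by
    intro i i' j j' u u' v v'
    simp [S, Matrix.one_apply, ite_and]
  have hval : ((ρ ⊗ₖ ρ) * S).trace = t ^ 2 * R.trace := by
    -- `S` is trivial on the ancillas, so only the two `A` marginals survive.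
    have h1 : ((ρ ⊗ₖ ρ) * S).trace = ∑ i, ∑ j, ∑ i', ∑ j',
        (∑ u, ρ (i, u) (i', u)) * (∑ v, ρ (j, v) (j', v)) * R (i', j') (i, j) := by
      simp only [Matrix.trace, Matrix.diag, Matrix.mul_apply, Fintype.sum_prod_type,
        Matrix.kroneckerMap_apply, hSapp, mul_ite, mul_zero, Finset.sum_ite_eq',
        Finset.sum_ite_irrel, Finset.sum_const_zero,
        Finset.mem_univ, if_true, Finset.mul_sum, Finset.sum_mul]
      simp only [← Fintype.sum_prod_type']
      exact Fintype.sum_equiv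
        ⟨fun x => (x.1, x.2.2.1, x.2.2.2.2.1, x.2.2.2.2.2, x.2.2.2.1, x.2.1),
          fun x => (x.1, x.2.2.2.2.2, x.2.1, x.2.2.2.2.1, x.2.2.1, x.2.2.2.1),
          fun _ => rfl, fun _ => rfl⟩ _ _ fun _ => rfl
    rw [h1]
    simp only [hA, ite_mul, zero_mul, mul_ite, mul_zero, Finset.sum_ite_eq, Finset.mem_univ,
      if_true, Matrix.trace, Matrix.diag, Fintype.sum_prod_type, Finset.mul_sum, sq]
  have hstar : ∀ p q, star (ρ p q) = ρ q p := fun p q => hρ.1.apply q p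
  rw [← hval, trace_tensorId]
  simp only [hstar]
  rcases hN with hN | hN
  -- Here `σ` swaps only the ancillas; in the other case it swaps both copies entirely, and `hswap`
  -- gives the invariance of `S`.
  · refine le_of_eq_of_le ?_ (trace_kronecker_submatrix_le hρ hS
      (σ := fun q => ((q.1.1, q.2.2), (q.2.1, q.1.2))) (fun _ => rfl) ?_)
    · simp only [Matrix.trace, Matrix.diag, Matrix.mul_apply, Fintype.sum_prod_type,
        Matrix.kroneckerMap_apply, Matrix.submatrix_apply, id, hSapp, mul_ite, mul_zero,
        Finset.sum_ite_eq', Finset.sum_ite_irrel, Finset.sum_const_zero, Finset.mem_univ, if_true, hN]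
      simp only [← Fintype.sum_prod_type']
      exact Fintype.sum_equiv
        ⟨fun x => (x.2.2.2.1, x.2.1, x.2.2.2.2.1, x.1, x.2.2.1, x.2.2.2.2.2),
          fun x => (x.2.2.2.1, x.2.1, x.2.2.2.2.1, x.1, x.2.2.1, x.2.2.2.2.2),
          fun _ => rfl, fun _ => rfl⟩ _ _ fun _ => rfl
    · rintro ⟨⟨i, u⟩, ⟨j, v⟩⟩ ⟨⟨i', u'⟩, ⟨j', v'⟩⟩
      simp only [hSapp]
      split_ifs <;> rfl
  · refine le_of_eq_of_le ?_ (trace_kronecker_submatrix_le hρ hS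
      (σ := Prod.swap) (fun _ => rfl) ?_)
    · simp only [Matrix.trace, Matrix.diag, Matrix.mul_apply, Fintype.sum_prod_type,
        Matrix.kroneckerMap_apply, Matrix.submatrix_apply, id, Prod.swap_prod_mk, hSapp,
        mul_ite, mul_zero,
        Finset.sum_ite_eq', Finset.sum_ite_irrel, Finset.sum_const_zero, Finset.mem_univ, if_true, hN]
      simp only [← Fintype.sum_prod_type']
      exact Fintype.sum_equiv
        ⟨fun x => (x.2.2.2.1, x.2.1, x.2.2.2.2.1, x.1, x.2.2.1, x.2.2.2.2.2),
          fun x => (x.2.2.2.1, x.2.1, x.2.2.2.2.1, x.1, x.2.2.1, x.2.2.2.2.2),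
          fun _ => rfl, fun _ => rfl⟩ _ _ fun _ => rfl
    · rintro ⟨⟨i, u⟩, ⟨j, v⟩⟩ ⟨⟨i', u'⟩, ⟨j', v'⟩⟩
      have := hswap (i, j) (i', j')
      simp only [Prod.swap_prod_mk] at this
      simp only [Prod.swap_prod_mk, hSapp, this]
      split_ifs <;> rfl

end QMap

/-! ### Channels attaining the bound -/

namespace QMap

variable {ι κ : Type*}

/-- Relabelling the basis is completely positive and trace preserving. -/
theorem isCPTP_reindex [Fintype ι] {ι' : Type*} [Fintype ι'] (e : ι ≃ ι') :
    IsCPTP (Matrix.reindexLinearEquiv ℂ ℂ e e : Op ι →ₗ[ℂ] Op ι') := by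
  refine ⟨fun k X hX => ?_, fun X => ?_⟩
  · convert hX.submatrix (fun p : ι' × Fin k => (e.symm p.1, p.2)) using 1
    ext r s
    rfl
  · exact Fintype.sum_equiv e.symm _ _ fun _ => rfl

/-- The trace, with values in the operators on `ℂ`, is completely positive and trace
preserving. -/
theorem isCPTP_trace [Fintype ι] :
    IsCPTP ((Matrix.traceLinearMap ι ℂ ℂ).smulRight (1 : Op (Fin 1))) := by
  refine ⟨fun k X hX => ?_, fun X => by simp⟩
  convert Matrix.posSemidef_sum Finset.univ fun i _ =>
    hX.submatrix (fun p : Fin 1 × Fin k => ((i : ι), p.2)) using 1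
  ext r s
  simp [tensorId, Matrix.trace, Matrix.sum_apply, Matrix.one_apply, Subsingleton.elim r.1 s.1]

theorem trace_output_reindex [Fintype ι] [DecidableEq ι] [Fintype κ] {ι' : Type*} [Fintype ι']
    (N : Op ι →ₗ[ℂ] Op κ)
    (e : ι ≃ ι') :
    ((tensorId N ι' (idTensor ι (Matrix.reindexLinearEquiv ℂ ℂ e e : Op ι →ₗ[ℂ] Op ι')
      (maxEntState ι)))ᴴ * tensorId N ι' (idTensor ι
        (Matrix.reindexLinearEquiv ℂ ℂ e e : Op ι →ₗ[ℂ] Op ι') (maxEntState ι))).trace =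
      (Fintype.card ι : ℂ)⁻¹ ^ 2 * ∑ u, ∑ v, hsGram N u v u v := by
  have h : ∀ (i j : ι) (u v : ι'), idTensor ι (Matrix.reindexLinearEquiv ℂ ℂ e e :
      Op ι →ₗ[ℂ] Op ι') (maxEntState ι) (i, u) (j, v) =
        if i = e.symm u then if j = e.symm v then (Fintype.card ι : ℂ)⁻¹ else 0 else 0 := by
    intro i j u v
    simp [idTensor, maxEntState_apply, ite_and]
  rw [trace_tensorId]
  simp only [h, apply_ite star, star_zero, mul_ite, ite_mul, zero_mul, mul_zero,
    Finset.sum_ite_eq', Finset.sum_ite_irrel, Finset.sum_const_zero, Finset.mem_univ, if_true]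
  rw [Finset.mul_sum]
  refine Fintype.sum_equiv e.symm _ _ fun u => ?_
  rw [Finset.mul_sum]
  refine Fintype.sum_equiv e.symm _ _ fun v => ?_
  simp [sq]

theorem trace_output_trace [Fintype ι] [DecidableEq ι] [Fintype κ] (N : Op ι →ₗ[ℂ] Op κ) :
    ((tensorId N (Fin 1) (idTensor ι ((Matrix.traceLinearMap ι ℂ ℂ).smulRight (1 : Op (Fin 1)))
      (maxEntState ι)))ᴴ * tensorId N (Fin 1) (idTensor ι
        ((Matrix.traceLinearMap ι ℂ ℂ).smulRight (1 : Op (Fin 1))) (maxEntState ι))).trace =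
      (Fintype.card ι : ℂ)⁻¹ ^ 2 * ∑ u, ∑ v, hsGram N u u v v := by
  have h : ∀ (i j : ι) (u v : Fin 1), idTensor ι ((Matrix.traceLinearMap ι ℂ ℂ).smulRight
      (1 : Op (Fin 1))) (maxEntState ι) (i, u) (j, v) =
        if i = j then (Fintype.card ι : ℂ)⁻¹ else 0 := by
    intro i j u v
    simp [idTensor, maxEntState_apply, Matrix.trace, Subsingleton.elim u v, ite_and, eq_comm]
  rw [trace_tensorId]
  simp only [h, apply_ite star, star_zero, mul_ite, ite_mul, zero_mul, mul_zero,
    Finset.sum_ite_eq, Finset.sum_ite_irrel, Finset.sum_const_zero, Finset.mem_univ, if_true]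
  simp [Finset.mul_sum, sq]

/-- The value of `upsilon 2 N` when the Gram matrix of `N` is one of the two partial
transpositions of a swap invariant positive semidefinite operator `R`. -/
theorem upsilon_two_eq [Fintype ι] [DecidableEq ι] [Fintype κ] [DecidableEq κ]
    (N : Op ι →ₗ[ℂ] Op κ)
    {R : Op (ι × ι)} (hR : R.PosSemidef) (hswap : ∀ p q, R (Prod.swap p) (Prod.swap q) = R p q)
    (hN : (∀ i' j' i j, hsGram N i' j' i j = R (i', j) (j', i)) ∨
      ∀ i' j' i j, hsGram N i' j' i j = R (j, i') (j', i)) :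
    upsilon 2 N = ENNReal.ofReal (√(((Fintype.card ι : ℂ)⁻¹ ^ 2 * R.trace).re)) := by
  apply le_antisymm
  · refine iSup_le fun m => iSup_le fun L => iSup_le fun hL => ?_
    rw [schattenNorm_two]
    exact ENNReal.ofReal_le_ofReal (Real.sqrt_le_sqrt (Complex.le_def.mp
      (trace_tensorId_le N hR hswap hN (posSemidef_idTensor hL.1 posSemidef_maxEntState)
        (sum_idTensor_maxEntState hL.2))).1)
  · rcases hN with hN | hN
    · refine le_trans (le_of_eq ?_) (le_iSup_of_le 1 (le_iSup_of_le _
        (le_iSup_of_le isCPTP_trace le_rfl)))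
      rw [schattenNorm_two, trace_output_trace]
      simp only [hN, Matrix.trace, Matrix.diag, Fintype.sum_prod_type]
    · refine le_trans (le_of_eq ?_) (le_iSup_of_le _ (le_iSup_of_le _
        (le_iSup_of_le (isCPTP_reindex (Fintype.equivFin ι)) le_rfl)))
      rw [schattenNorm_two, trace_output_reindex, Finset.sum_comm]
      simp only [hN, Matrix.trace, Matrix.diag, Fintype.sum_prod_type]

/-! ### The kernel `x + y F` and its tensor powers -/

/-- The operator `x + y F` on `ℂ^ι ⊗ ℂ^ι`, where `F` is the swap. -/
noncomputable def swapKernel (ι : Type*) [DecidableEq ι] (x y : ℝ) : Op (ι × ι) :=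
  (x : ℂ) • 1 + (y : ℂ) • (1 : Op (ι × ι)).submatrix Prod.swap id

theorem swapKernel_apply [DecidableEq ι] (x y : ℝ) (i j k l : ι) : swapKernel ι x y (i, j) (k, l) =
    (if i = k ∧ j = l then (x : ℂ) else 0) + if j = k ∧ i = l then (y : ℂ) else 0 := by
  simp [swapKernel, Matrix.one_apply]

theorem swapKernel_swap [DecidableEq ι] (x y : ℝ) (p q : ι × ι) :
    swapKernel ι x y p.swap q.swap = swapKernel ι x y p q := by
  obtain ⟨i, j⟩ := p
  obtain ⟨k, l⟩ := q
  simp only [Prod.swap_prod_mk, swapKernel_apply, and_comm]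

theorem posSemidef_swapKernel [Fintype ι] [DecidableEq ι] {x y : ℝ} (hy : 0 ≤ y) (hxy : y ≤ x) :
    (swapKernel ι x y).PosSemidef := by
  have h1 := (Matrix.PosSemidef.one : (1 : Op (ι × ι)).PosSemidef)
  have h2 := (h1.add_smul_submatrix_involutive (σ := Prod.swap) Prod.swap_swap
    (fun p q => by simp [Matrix.one_apply, Prod.swap_inj]) (ε := 1) (by norm_num)).smul hy
  -- `x + y F = (x - y) + y (1 + F)`.
  convert (h1.smul (sub_nonneg.mpr hxy)).add h2 using 1
  ext p q
  simp [swapKernel]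
  ring

theorem trace_swapKernel [Fintype ι] [DecidableEq ι] (x y : ℝ) : (swapKernel ι x y).trace =
    x * (Fintype.card ι : ℂ) ^ 2 + y * Fintype.card ι := by
  simp [Matrix.trace, Fintype.sum_prod_type, swapKernel_apply, Finset.sum_add_distrib, ite_and]
  ring

/-- The `n`-fold tensor power of an operator on `ℂ^ι ⊗ ℂ^ι`, on `(ℂ^ι)^{⊗n} ⊗ (ℂ^ι)^{⊗n}`. -/
def pairPow (R : Op (ι × ι)) (n : ℕ) : Op ((Fin n → ι) × (Fin n → ι)) :=
  Matrix.of fun p q => ∏ k, R (p.1 k, p.2 k) (q.1 k, q.2 k)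

theorem posSemidef_pairPow [Fintype ι] {R : Op (ι × ι)} (hR : R.PosSemidef) (n : ℕ) :
    (pairPow R n).PosSemidef :=
  (hR.prod_apply n).submatrix fun (p : (Fin n → ι) × (Fin n → ι)) k => (p.1 k, p.2 k)

theorem pairPow_swap {R : Op (ι × ι)} (hR : ∀ p q, R (Prod.swap p) (Prod.swap q) = R p q) (n : ℕ)
    (p q : (Fin n → ι) × (Fin n → ι)) : pairPow R n p.swap q.swap = pairPow R n p q :=
  show ∏ _, _ = ∏ _, _ from
    Finset.prod_congr rfl fun k _ => hR (p.1 k, p.2 k) (q.1 k, q.2 k)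

theorem trace_pairPow [Fintype ι] (R : Op (ι × ι)) (n : ℕ) : (pairPow R n).trace = R.trace ^ n := by
  simp only [Matrix.trace, Matrix.diag, Finset.sum_pow', Fintype.piFinset_univ, pairPow,
    Matrix.of_apply]
  exact Fintype.sum_equiv (Equiv.arrowProdEquivProdArrow (Fin n) (fun _ => ι) (fun _ => ι)).symm _ _
    fun _ => rfl

theorem hsGram_of_comp [Fintype ι] [DecidableEq ι] [Fintype κ] {N : Op ι →ₗ[ℂ] Op κ} {a b : ℝ}
    (hNN : hsAdjoint N ∘ₗ N =
      (a : ℂ) • LinearMap.id + (b : ℂ) • (Matrix.traceLinearMap ι ℂ ℂ).smulRight 1)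
    (i' j' i j : ι) : hsGram N i' j' i j =
      (if i = i' ∧ j = j' then (a : ℂ) else 0) + if i = j ∧ i' = j' then (b : ℂ) else 0 := by
  have h := congrFun (congrFun (LinearMap.congr_fun hNN (Matrix.single i j 1)) i') j'
  simp only [LinearMap.comp_apply] at h
  rw [hsGram, h]
  by_cases hij : i = j
  · subst hij; simp [Matrix.single_apply, Matrix.one_apply]
  · simp [Matrix.single_apply, hij]

/-- The value and the multiplicativity of `upsilon 2` for a map whose Gram matrix is one of the two
partial transpositions of `x + y F`. -/
theorem upsilon_two_tensorPow_eq [Fintype ι] [DecidableEq ι] [Nonempty ι]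
    [Fintype κ] [DecidableEq κ] (N : Op ι →ₗ[ℂ] Op κ)
    {x y : ℝ} (hy : 0 ≤ y) (hxy : y ≤ x)
    (hN : (∀ i' j' i j, hsGram N i' j' i j = swapKernel ι x y (i', j) (j', i)) ∨
      ∀ i' j' i j, hsGram N i' j' i j = swapKernel ι x y (j, i') (j', i)) :
    upsilon 2 N = ENNReal.ofReal (√(x + y / Fintype.card ι)) ∧
      ∀ n : ℕ, upsilon 2 (tensorPow N n) = upsilon 2 N ^ n := by
  have hcard : (Fintype.card ι : ℂ) ≠ 0 := by exact_mod_cast Fintype.card_ne_zero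
  have hval : (Fintype.card ι : ℂ)⁻¹ ^ 2 * (swapKernel ι x y).trace =
      ((x + y / Fintype.card ι : ℝ) : ℂ) := by
    rw [trace_swapKernel]
    push_cast
    field_simp
  have hone : upsilon 2 N = ENNReal.ofReal (√(x + y / Fintype.card ι)) := by
    rw [upsilon_two_eq N (posSemidef_swapKernel hy hxy) (swapKernel_swap x y) hN, hval,
      Complex.ofReal_re]
  refine ⟨hone, fun n => ?_⟩
  rw [upsilon_two_eq (tensorPow N n) (posSemidef_pairPow (posSemidef_swapKernel hy hxy) n)
    (pairPow_swap (swapKernel_swap x y) n)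
    (hN.imp (fun h i' j' i j => by simp only [hsGram_tensorPow, h, pairPow, Matrix.of_apply])
      (fun h i' j' i j => by simp only [hsGram_tensorPow, h, pairPow, Matrix.of_apply])),
    hone, ← ENNReal.ofReal_pow (Real.sqrt_nonneg _), trace_pairPow]
  have hpow : (Fintype.card (Fin n → ι) : ℂ)⁻¹ ^ 2 * (swapKernel ι x y).trace ^ n =
      (((x + y / Fintype.card ι) ^ n : ℝ) : ℂ) := by
    rw [Complex.ofReal_pow, ← hval, Fintype.card_pi_const, mul_pow, Nat.cast_pow, ← inv_pow,
      ← pow_mul, ← pow_mul, mul_comm n]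
  have hnonneg : 0 ≤ x + y / Fintype.card ι := add_nonneg (hy.trans hxy) (by positivity)
  rw [hpow, Complex.ofReal_re]
  congr 1
  rw [Real.sqrt_eq_iff_mul_self_eq (by positivity) (by positivity), ← mul_pow,
    Real.mul_self_sqrt hnonneg]

end QMap

/-! ### The two regimes `a ≤ b` and `b ≤ a` -/

theorem mainTheorem2 (d c : ℕ) (hd : 0 < d)
    (N : QMap.Op (Fin d) →ₗ[ℂ] QMap.Op (Fin c)) (hN : QMap.IsCP N)
    (a b : ℝ) (ha : 0 ≤ a) (hb : 0 ≤ b)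
    (hNN : QMap.hsAdjoint N ∘ₗ N =
      (a : ℂ) • LinearMap.id + (b : ℂ) • (Matrix.traceLinearMap (Fin d) ℂ ℂ).smulRight 1) :
    QMap.upsilon 2 N = ENNReal.ofReal (√(max (a + b / d) (a / d + b))) ∧
      ∀ n : ℕ, QMap.upsilon 2 (QMap.tensorPow N n) = QMap.upsilon 2 N ^ n := by
  have : Nonempty (Fin d) := ⟨⟨0, hd⟩⟩
  have hd' : (1 : ℝ) ≤ d := by exact_mod_cast hd
  have hgram := QMap.hsGram_of_comp hNN
  -- The larger coefficient should be the undivided one: `(x - y) / d ≤ x - y`.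
  have hdiv : ∀ x y : ℝ, y ≤ x → y + x / d ≤ x + y / d := by
    intro x y hxy
    have h := div_le_self (sub_nonneg.mpr hxy) hd'
    rw [sub_div] at h
    linarith
  rcases le_total a b with hab | hab
  · have hmax : max (a + b / d) (a / d + b) = b + a / d := by
      rw [add_comm (a / d), max_eq_right (hdiv b a hab)]
    have h := QMap.upsilon_two_tensorPow_eq N ha hab (Or.inl fun i' j' i j => by
      rw [hgram, QMap.swapKernel_apply, add_comm]
      congr 1 <;> congr 1 <;> simp only [eq_iff_iff] <;> constructor <;>
        rintro ⟨rfl, rfl⟩ <;> exact ⟨rfl, rfl⟩)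
    rwa [Fintype.card_fin, ← hmax] at h
  · have hmax : max (a + b / d) (a / d + b) = a + b / d := by
      rw [add_comm (a / d), max_eq_left (hdiv a b hab)]
    have h := QMap.upsilon_two_tensorPow_eq N hb hab (Or.inr fun i' j' i j => by
      rw [hgram, QMap.swapKernel_apply]
      congr 1 <;> congr 1 <;> simp only [eq_iff_iff] <;> constructor <;>
        rintro ⟨rfl, rfl⟩ <;> exact ⟨rfl, rfl⟩)
    rwa [Fintype.card_fin, ← hmax] at h
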